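/- Consider a noise-free line network with nodes $0,1,\dots,m+1$, where node $0$ is the source, nodes $1,\dots,m$ are half-duplex relays and node $m+1$ is the destination. In each channel use, node $i\in\{0,\dots,m\}$ sends a symbol $X_i\in\{0,1,\mathrm N\}$, where $\mathrm N$ means "not transmitting". Relay $i\in\{1,\dots,m\}$ receives $Y_i=X_{i-1}$ if $X_i=\mathrm N$ and $Y_i=X_i$ if $X_i\in\{0,1\}$; the destination receives $Y_{m+1}=X_m$. Each relay follows either the ternary model (no further restriction) or the binary model, in which the pair $(X_{i-1},X_i)=(\mathrm N,\mathrm N)$ is not allowed; in particular, all relays may be ternary or all may be binary. Only the source has a message. In a code of block length $n\ge 1$ with $M$ messages, the $n$ source symbols are a function of the message, the symbol sent by a relay at time $t$ is a function of the symbols it received before time $t$, and the destination decodes from the $n$ symbols it received. The code is a zero-error code if, for every message, the symbols sent respect the relay models in each channel use and the destination decodes the message correctly. The zero-error capacity $C$ is the supremum of the rates $\frac1n\log_2 M$ of all zero-error codes. **Theorem.** The zero-error capacity is finite and equals $$C=\max_{p(x_0,\dots,x_m)}\ \min\bigl\{H(Y_1|X_1),\dots,H(Y_m|X_m),\,H(Y_{m+1})\bigr\},$$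 where the entropies are in bits, and the maximum, which is attained, is over all joint probability mass functions of $(X_0,\dots,X_m)$ on $\{0,1,\mathrm N\}^{m+1}$ for which $X_0\to X_1\to\cdots\to X_m$ is a Markov chain and which assign probability zero to all input vectors excluded by the relay models. -/

import Mathlib

noncomputable section

namespace HalfDuplexLine

/-- The channel alphabet `{0, 1, N}`: `some b` is a transmitted bit, `none` is the symbol `N`
("the node does not transmit in this channel use"). -/
abbrev Sym : Type := Option Bool

/-- The two half-duplex relay models. In both of them the channel acts in the same way; in the
binary model the input pair `(N, N)` of the preceding node and the relay is excluded. -/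
inductive RelayModel : Type
  | ternary
  | binary

/-! ### The network

Node `0` is the source, nodes `1, …, m` are the relays and node `m + 1` is the sink. The inputs of
one channel use are `x : Fin (m + 1) → Sym`, where `x j` is the symbol sent by node `j`. Relays are
indexed by `i : Fin m`: this is node `i + 1`, which sends `x i.succ`, and whose predecessor sends
`x i.castSucc`. -/

/-- The symbol received by the relay with index `i` (node `i + 1`): what the preceding node sends
if the relay is quiet, and its own symbol if the relay transmits. -/
def relayOutput {m : ℕ} (x : Fin (m + 1) → Sym) (i : Fin m) : Sym :=
  match x i.succ with
  | none => x i.castSucc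
  | some b => some b

/-- The symbol received by the sink (node `m + 1`): the symbol sent by node `m`. -/
def sinkOutput {m : ℕ} (x : Fin (m + 1) → Sym) : Sym := x (Fin.last m)

/-- The inputs that the relay models permit in one channel use: a binary relay and its predecessor
are never both quiet. -/
def Admissible {m : ℕ} (model : Fin m → RelayModel) (x : Fin (m + 1) → Sym) : Prop :=
  ∀ i : Fin m, model i = RelayModel.binary → ¬ (x i.castSucc = none ∧ x i.succ = none)

/-! ### Codes and zero-error capacity -/

/-- A code of block length `n` with `M` messages for the line network with `m` relays.
The source knows the message; what a relay sends at time `t` is a function of the symbols that this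
relay received at times `s < t`; the sink decodes from the `n` symbols that it received. -/
structure Code (m n M : ℕ) where
  source : Fin M → Fin n → Sym
  relay : Fin m → (t : Fin n) → (Fin t.val → Sym) → Sym
  decode : (Fin n → Sym) → Fin M

/-- `c.inputs w t j` is the symbol that node `j` sends at time `t` when the message is `w`. -/
def Code.inputs {m n M : ℕ} (c : Code m n M) (w : Fin M) (t : Fin n) : Fin (m + 1) → Sym :=
  Fin.cons (c.source w t) fun i : Fin m =>
    c.relay i t fun s : Fin t.val => relayOutput (c.inputs w ⟨s.val, s.isLt.trans t.isLt⟩) i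
termination_by t.val
decreasing_by exact s.isLt

/-- The code respects the relay models and the sink recovers every message without error. -/
def Code.IsZeroError {m n M : ℕ} (model : Fin m → RelayModel) (c : Code m n M) : Prop :=
  ∀ w : Fin M,
    (∀ t : Fin n, Admissible model (c.inputs w t)) ∧
      c.decode (fun t => sinkOutput (c.inputs w t)) = w

/-- The rates `(log₂ M) / n`, in bits per channel use, of all zero-error codes. -/
def zeroErrorRates {m : ℕ} (model : Fin m → RelayModel) : Set ℝ :=
  {R | ∃ n M : ℕ, 0 < n ∧ (∃ c : Code m n M, c.IsZeroError model) ∧ R = Real.logb 2 M / n}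

/-- The zero-error capacity: the supremum of the rates of zero-error codes. -/
def zeroErrorCapacity {m : ℕ} (model : Fin m → RelayModel) : ℝ := sSup (zeroErrorRates model)

/-! ### Entropy

`p : Ω → ℝ` is a probability mass function on a finite set, and random variables are functions
on `Ω`. -/

section Entropy

variable {Ω α β : Type*} [Fintype Ω] [Fintype α] [Fintype β]

open Classical in
/-- The probability of the event `E`. -/
def prob (p : Ω → ℝ) (E : Ω → Prop) : ℝ := ∑ ω with E ω, p ω

/-- The entropy `H(Y)` in bits. -/
def entropy (p : Ω → ℝ) (Y : Ω → α) : ℝ :=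
  -∑ y, prob p (fun ω => Y ω = y) * Real.logb 2 (prob p fun ω => Y ω = y)

/-- The conditional entropy `H(Y | X) = -∑ p(x, y) log₂ p(y | x)` in bits. -/
def condEntropy (p : Ω → ℝ) (Y : Ω → α) (X : Ω → β) : ℝ :=
  -∑ x, ∑ y, prob p (fun ω => X ω = x ∧ Y ω = y) *
    Real.logb 2 (prob p (fun ω => X ω = x ∧ Y ω = y) / prob p fun ω => X ω = x)

end Entropy

/-! ### Input distributions -/

/-- Under the joint distribution `p` of the inputs, `X 0 → X 1 → ⋯ → X m` is a Markov chain: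
`p(x_0, …, x_{i+1}) p(x_i) = p(x_0, …, x_i) p(x_i, x_{i+1})` for all `i < m`. -/
def IsMarkovChain {m : ℕ} (p : (Fin (m + 1) → Sym) → ℝ) : Prop :=
  ∀ (i : Fin m) (x : Fin (m + 1) → Sym),
    prob p (fun X => ∀ j ≤ i.succ, X j = x j) * prob p (fun X => X i.castSucc = x i.castSucc) =
      prob p (fun X => ∀ j ≤ i.castSucc, X j = x j) *
        prob p (fun X => X i.castSucc = x i.castSucc ∧ X i.succ = x i.succ)

/-- The joint probability mass functions of `(X 0, …, X m)` over which the maximum is taken: the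
Markov chains that are supported on the inputs permitted by the relay models. -/
def inputDistributions {m : ℕ} (model : Fin m → RelayModel) : Set ((Fin (m + 1) → Sym) → ℝ) :=
  {p | p ∈ stdSimplex ℝ (Fin (m + 1) → Sym) ∧ (∀ x, p x ≠ 0 → Admissible model x) ∧
    IsMarkovChain p}

/-- `min {H(Y_1 | X_1), …, H(Y_m | X_m), H(Y_{m+1})}`; the index `some i` stands for the relay
with index `i`, and `none` for the sink. -/
def minEntropy {m : ℕ} (p : (Fin (m + 1) → Sym) → ℝ) : ℝ :=
  Finset.univ.inf' Finset.univ_nonempty fun k : Option (Fin m) =>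
    match k with
    | some i => condEntropy p (fun X => relayOutput X i) (fun X => X i.succ)
    | none => entropy p (sinkOutput (m := m))

end HalfDuplexLine

end

/-!
The capacity is squeezed between a counting bound and a block coding scheme.

*Converse.* In a zero-error code the word received by any node determines the message, because it
determines the words sent by that node and by all later ones
(`Code.IsZeroError.relayOutput_injective`). Let `p` be the empirical distribution of the inputs over
all messages and all times, and let `q(y | x)` be its conditional distribution of `Y_i` given `X_i`.
Since `X_i` at time `t` is a function of the past of `Y_i`, the products `∏ q(y_t | x_t)` form a
sub-probability on words, and comparing it with the uniform distribution on the `M` distinct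
received words gives `log₂ M ≤ n H(Y_i | X_i)` without any chain rule
(`logb_le_mul_condEntropy_empirical`). The entropies and the admissibility constraints depend only
on the laws of the pairs `(X_i, X_{i+1})` and of `X_m`, so `p` may be replaced by the Markov chain with the same
laws (`exists_mem_inputDistributions`).

*Achievability.* Approximate `p` by the empirical distribution of a word `z` of length `K` whose
letters are admissible input vectors (`exists_tendsto_empirical`). In each block every node sends
a rearrangement of its own component of `z`. Node `j` uses the permutation of node `j + 1`,
which it knows since that one depends on older messages only, multiplied by a permutation that
preserves the component `j + 1` of `z` and encodes the next message. So the pairs of symbols of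
consecutive nodes are always those of a letter of `z`, and node `j + 1` can decode when distinct
messages rearrange its base output word differently (`mem_zeroErrorRates_of_perms`). The number of
such rearrangements is a quotient of products of factorials, which is `2 ^ (K H(Y | X))` up to a
factor polynomial in `K` (`mul_condEntropy_sub_le_logb_card`). The rate lost to the `m` blocks of
delay vanishes as the number of blocks grows.

The maximum is attained since the set of input distributions is compact and the minimum of the
entropies is continuous on it.
-/

noncomputable section

namespace HalfDuplexLine

/-! ### Probabilities and entropies -/

section Prob

variable {Ω α β : Type*} [Fintype Ω] [Fintype α] [Fintype β]

open Classical in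
lemma prob_eq_sum_ite (p : Ω → ℝ) (E : Ω → Prop) : prob p E = ∑ ω, if E ω then p ω else 0 := by
  simp [prob, Finset.sum_filter]

lemma prob_nonneg {p : Ω → ℝ} (hp : ∀ ω, 0 ≤ p ω) (E : Ω → Prop) : 0 ≤ prob p E :=
  Finset.sum_nonneg fun ω _ => hp ω

lemma prob_mono {p : Ω → ℝ} (hp : ∀ ω, 0 ≤ p ω) {E F : Ω → Prop} (h : ∀ ω, E ω → F ω) :
    prob p E ≤ prob p F := by
  classical
  exact Finset.sum_le_sum_of_subset_of_nonneg
    (fun ω => by simpa using h ω) fun ω _ _ => hp ω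

lemma prob_true (p : Ω → ℝ) : prob p (fun _ => True) = ∑ ω, p ω := by
  simp [prob]

/-- The law of total probability. -/
lemma sum_prob_and (p : Ω → ℝ) (E : Ω → Prop) (Y : Ω → α) :
    ∑ y, prob p (fun ω => E ω ∧ Y ω = y) = prob p E := by
  classical
  simp only [prob_eq_sum_ite]
  rw [Finset.sum_comm]
  refine Finset.sum_congr rfl fun ω _ => ?_
  by_cases h : E ω <;> simp [h]

lemma prob_eq_zero_of_le {p : Ω → ℝ} (hp : ∀ ω, 0 ≤ p ω) {E F : Ω → Prop}
    (h : ∀ ω, E ω → F ω) (hF : prob p F = 0) : prob p E = 0 :=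
  le_antisymm (hF ▸ prob_mono hp h) (prob_nonneg hp E)

lemma exists_of_prob_ne_zero {p : Ω → ℝ} {E : Ω → Prop} (h : prob p E ≠ 0) :
    ∃ ω, p ω ≠ 0 ∧ E ω := by
  classical
  obtain ⟨ω, hω, h'⟩ := Finset.exists_ne_zero_of_sum_ne_zero h
  exact ⟨ω, h', by simpa using hω⟩

lemma le_prob {p : Ω → ℝ} (hp : ∀ ω, 0 ≤ p ω) {E : Ω → Prop} {ω : Ω} (h : E ω) :
    p ω ≤ prob p E := by
  classical
  exact Finset.single_le_sum (f := p) (fun ω _ => hp ω) (by simpa using h)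

lemma continuous_prob (E : Ω → Prop) : Continuous fun p : Ω → ℝ => prob p E := by
  unfold prob
  fun_prop

/-- The entropy is the conditional entropy given a constant. -/
lemma entropy_eq_condEntropy {p : Ω → ℝ} (hp : ∑ ω, p ω = 1) (Y : Ω → α) :
    entropy p Y = condEntropy p Y (fun _ => ()) := by
  simp [entropy, condEntropy, prob_true, hp]

/-- `H(Y | X) = H(X, Y) - H(X)`; the right-hand side is visibly continuous in `p`. -/
lemma condEntropy_eq_negMulLog {p : Ω → ℝ} (hp : ∀ ω, 0 ≤ p ω) (Y : Ω → α) (X : Ω → β) :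
    condEntropy p Y X = (∑ x, (∑ y, Real.negMulLog (prob p fun ω => X ω = x ∧ Y ω = y) -
      Real.negMulLog (prob p fun ω => X ω = x))) / Real.log 2 := by
  rw [condEntropy, ← Finset.sum_neg_distrib, Finset.sum_div]
  refine Finset.sum_congr rfl fun x _ => ?_
  rw [← sum_prob_and p (fun ω => X ω = x) Y, Real.negMulLog, neg_mul, sub_neg_eq_add,
    Finset.sum_mul, ← Finset.sum_add_distrib, Finset.sum_div, ← Finset.sum_neg_distrib]
  refine Finset.sum_congr rfl fun y _ => ?_
  rw [sum_prob_and p (fun ω => X ω = x) Y]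
  rcases (prob_nonneg hp fun ω => X ω = x ∧ Y ω = y).eq_or_lt with h | h
  · simp [← h]
  · have h' : 0 < prob p fun ω => X ω = x := h.trans_le (prob_mono hp fun ω hω => hω.1)
    rw [Real.logb, Real.log_div h.ne' h'.ne', Real.negMulLog]
    ring

lemma continuousOn_condEntropy (Y : Ω → α) (X : Ω → β) :
    ContinuousOn (fun p : Ω → ℝ => condEntropy p Y X) {p | ∀ ω, 0 ≤ p ω} := by
  refine ContinuousOn.congr (Continuous.continuousOn ?_)
    fun p hp => condEntropy_eq_negMulLog hp Y X
  refine Continuous.div_const (continuous_finsetSum _ fun x _ => Continuous.sub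
    (continuous_finsetSum _ fun y _ => ?_) ?_) _
  · exact Real.continuous_negMulLog.comp (continuous_prob _)
  · exact Real.continuous_negMulLog.comp (continuous_prob _)

end Prob

/-! ### Empirical distributions -/

section Empirical

variable {ι Ω α β : Type*} [Fintype ι] [Fintype α] [Fintype β]

open Classical in
/-- The number of indices at which `P` holds. -/
def freq (P : ι → Prop) : ℕ := (Finset.univ.filter P).card

open Classical in
lemma freq_eq_sum (P : ι → Prop) : (freq P : ℝ) = ∑ i, if P i then (1 : ℝ) else 0 := by
  simp [freq]

lemma freq_pos {P : ι → Prop} {i : ι} (h : P i) : 0 < freq P := by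
  classical
  exact Finset.card_pos.2 ⟨i, by simpa using h⟩

lemma freq_le_card (P : ι → Prop) : freq P ≤ Fintype.card ι := Finset.card_le_univ _

lemma sum_freq_and (P : ι → Prop) (Y : ι → α) :
    ∑ y, (freq (fun i => P i ∧ Y i = y) : ℝ) = freq P := by
  classical
  simp only [freq_eq_sum]
  rw [Finset.sum_comm]
  refine Finset.sum_congr rfl fun ω _ => ?_
  by_cases h : P ω <;> simp [h]

/-- The empirical distribution of a finite family `z`: the relative frequencies of its values. -/
def empirical (z : ι → Ω) (ω : Ω) : ℝ := (freq fun i => z i = ω : ℕ) / Fintype.card ι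

lemma prob_empirical [Fintype Ω] (z : ι → Ω) (E : Ω → Prop) :
    prob (empirical z) E = (freq fun i => E (z i) : ℕ) / Fintype.card ι := by
  classical
  have h (ω : Ω) : (if E ω then empirical z ω else 0) =
      (∑ i, if E (z i) ∧ z i = ω then (1 : ℝ) else 0) / Fintype.card ι := by
    rw [empirical, freq_eq_sum]
    split_ifs with hE
    · congr 1
      refine Finset.sum_congr rfl fun i _ => ?_
      by_cases hi : z i = ω <;> simp [hi, hE]
    · rw [eq_comm, div_eq_zero_iff]
      refine Or.inl (Finset.sum_eq_zero fun i _ => if_neg ?_)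
      rintro ⟨h1, rfl⟩
      exact hE h1
  rw [prob_eq_sum_ite, Finset.sum_congr rfl fun ω _ => h ω, ← Finset.sum_div, Finset.sum_comm,
    freq_eq_sum]
  congr 1
  refine Finset.sum_congr rfl fun i _ => ?_
  by_cases hi : E (z i) <;> simp [hi]

lemma empirical_mem_stdSimplex [Fintype Ω] [Nonempty ι] (z : ι → Ω) :
    empirical z ∈ stdSimplex ℝ Ω := by
  refine ⟨fun ω => by unfold empirical; positivity, ?_⟩
  rw [← prob_true, prob_empirical]
  simp [freq]

lemma exists_of_empirical_ne_zero {z : ι → Ω} {ω : Ω} (h : empirical z ω ≠ 0) :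
    ∃ i, z i = ω := by
  classical
  by_contra! h'
  exact h (by simp [empirical, freq, h'])

/-- The conditional entropy of an empirical distribution, in terms of counts. -/
lemma card_mul_condEntropy_empirical [Fintype Ω] [Nonempty ι] (z : ι → Ω) (Y : Ω → α)
    (X : Ω → β) :
    Fintype.card ι * condEntropy (empirical z) Y X =
      -∑ x, ∑ y, (freq fun i => X (z i) = x ∧ Y (z i) = y : ℕ) *
        Real.logb 2 ((freq fun i => X (z i) = x ∧ Y (z i) = y : ℕ) /
          (freq fun i => X (z i) = x : ℕ)) := by
  have hc : (Fintype.card ι : ℝ) ≠ 0 := by simp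
  rw [condEntropy, mul_neg, Finset.mul_sum]
  congr 1
  refine Finset.sum_congr rfl fun x _ => ?_
  rw [Finset.mul_sum]
  refine Finset.sum_congr rfl fun y _ => ?_
  rw [prob_empirical, prob_empirical, div_div_div_cancel_right₀ hc, ← mul_assoc,
    mul_div_cancel₀ _ hc]

/-- The conditional entropy of an empirical distribution as an average over the family. -/
lemma card_mul_condEntropy_empirical_eq_sum [Fintype Ω] [Nonempty ι] (z : ι → Ω) (Y : Ω → α)
    (X : Ω → β) :
    Fintype.card ι * condEntropy (empirical z) Y X =
      -∑ i, Real.logb 2 ((freq fun j => X (z j) = X (z i) ∧ Y (z j) = Y (z i) : ℕ) /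
          (freq fun j => X (z j) = X (z i) : ℕ)) := by
  classical
  rw [card_mul_condEntropy_empirical]
  congr 1
  simp only [freq_eq_sum (fun i => X (z i) = _ ∧ Y (z i) = _), Finset.sum_mul]
  simp only [← freq_eq_sum]
  rw [Finset.sum_congr rfl fun x _ => Finset.sum_comm, Finset.sum_comm]
  refine Finset.sum_congr rfl fun i _ => ?_
  rw [Finset.sum_eq_single (X (z i)), Finset.sum_eq_single (Y (z i))]
  · simp
  · intro y _ hy
    simp [hy.symm]
  · simp
  · intro x _ hx
    exact Finset.sum_eq_zero fun y _ => by simp [hx.symm]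
  · simp

end Empirical

/-! ### The maximum is attained -/

lemma entropy_sinkOutput {m : ℕ} {p : (Fin (m + 1) → Sym) → ℝ}
    (hp : p ∈ stdSimplex ℝ (Fin (m + 1) → Sym)) :
    entropy p (sinkOutput (m := m)) = condEntropy p (sinkOutput (m := m)) (fun _ => ()) :=
  entropy_eq_condEntropy hp.2 _

lemma le_minEntropy_iff {m : ℕ} {p : (Fin (m + 1) → Sym) → ℝ} {r : ℝ}
    (hp : p ∈ stdSimplex ℝ (Fin (m + 1) → Sym)) :
    r ≤ minEntropy p ↔
      (∀ i : Fin m, r ≤ condEntropy p (fun X => relayOutput X i) (fun X => X i.succ)) ∧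
        r ≤ condEntropy p (sinkOutput (m := m)) (fun _ => ()) := by
  rw [minEntropy, Finset.le_inf'_iff, ← entropy_sinkOutput hp]
  constructor
  · exact fun h => ⟨fun i => h (some i) (Finset.mem_univ _), h none (Finset.mem_univ _)⟩
  · rintro ⟨h1, h2⟩ (_ | i) _
    exacts [h2, h1 i]

lemma continuousOn_minEntropy (m : ℕ) :
    ContinuousOn (minEntropy (m := m)) (stdSimplex ℝ (Fin (m + 1) → Sym)) := by
  unfold minEntropy
  refine ContinuousOn.finset_inf'_apply _ fun k _ => ?_
  cases k with
  | none =>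
    exact ((continuousOn_condEntropy _ _).mono fun p hp => hp.1).congr
      fun p hp => entropy_sinkOutput hp
  | some i => exact (continuousOn_condEntropy _ _).mono fun p hp => hp.1

lemma isCompact_inputDistributions {m : ℕ} (model : Fin m → RelayModel) :
    IsCompact (inputDistributions model) := by
  have h1 : IsClosed {p : (Fin (m + 1) → Sym) → ℝ | ∀ x, p x ≠ 0 → Admissible model x} := by
    simp only [ne_eq, not_imp_comm (a := _ = (0 : ℝ)), Set.ofPred_forall]
    exact isClosed_iInter fun x => isClosed_iInter fun _ =>
      isClosed_eq (continuous_apply x) continuous_const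
  have h2 : IsClosed {p : (Fin (m + 1) → Sym) → ℝ | IsMarkovChain p} := by
    simp only [IsMarkovChain, Set.ofPred_forall]
    exact isClosed_iInter fun i => isClosed_iInter fun x =>
      isClosed_eq ((continuous_prob _).mul (continuous_prob _))
        ((continuous_prob _).mul (continuous_prob _))
  exact (isCompact_stdSimplex ℝ (Fin (m + 1) → Sym)).inter_right (h1.inter h2)

/-! ### Markov chains with prescribed pair marginals -/

section Markov

variable {m : ℕ}

lemma prob_eq_single (p : (Fin m → Sym) → ℝ) (x : Fin m → Sym) :
    prob p (fun X => X = x) = p x := by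
  rw [prob_eq_sum_ite]
  exact (Finset.sum_eq_single x (fun y _ h => if_neg h) (by simp)).trans (if_pos rfl)

open Classical in
lemma prob_eq_sum_snoc (p : (Fin (m + 1) → Sym) → ℝ) (E : (Fin (m + 1) → Sym) → Prop) :
    prob p E = ∑ x : Fin m → Sym, ∑ a : Sym,
      if E (Fin.snoc x a) then p (Fin.snoc x a) else 0 := by
  rw [prob_eq_sum_ite, ← (Fin.snocEquiv fun _ => Sym).sum_comp, Fintype.sum_prod_type,
    Finset.sum_comm]
  rfl

/-- The probability of an event that depends only on two consecutive inputs. -/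
lemma prob_pair_congr {p q : (Fin (m + 1) → Sym) → ℝ} {i : Fin m}
    (h : ∀ a b, prob q (fun X => X i.castSucc = a ∧ X i.succ = b) =
      prob p (fun X => X i.castSucc = a ∧ X i.succ = b)) (E : Sym → Sym → Prop) :
    prob q (fun X => E (X i.castSucc) (X i.succ)) =
      prob p (fun X => E (X i.castSucc) (X i.succ)) := by
  classical
  have key (r : (Fin (m + 1) → Sym) → ℝ) : prob r (fun X => E (X i.castSucc) (X i.succ)) =
      ∑ a, ∑ b, if E a b then prob r (fun X => X i.castSucc = a ∧ X i.succ = b) else 0 := by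
    rw [← sum_prob_and r _ fun X => X i.castSucc]
    refine Finset.sum_congr rfl fun a _ => ?_
    rw [← sum_prob_and r _ fun X => X i.succ]
    refine Finset.sum_congr rfl fun b _ => ?_
    split_ifs with hE
    · congr 1
      ext X
      grind
    · rw [prob_eq_sum_ite]
      exact Finset.sum_eq_zero fun X _ => if_neg (by grind)
  simp only [key, h]

/-- The Markov chain with the same consecutive pair marginals as `p`: it is obtained by
letting each input depend on its predecessor through the transition probabilities of `p`. -/
lemma exists_isMarkovChain (p : (Fin (m + 1) → Sym) → ℝ)
    (hp : p ∈ stdSimplex ℝ (Fin (m + 1) → Sym)) :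
    ∃ q ∈ stdSimplex ℝ (Fin (m + 1) → Sym), IsMarkovChain q ∧
      (∀ (i : Fin m) (a b : Sym), prob q (fun X => X i.castSucc = a ∧ X i.succ = b) =
        prob p (fun X => X i.castSucc = a ∧ X i.succ = b)) ∧
      ∀ a, prob q (fun X => X (Fin.last m) = a) = prob p (fun X => X (Fin.last m) = a) := by
  classical
  induction m with
  | zero => exact ⟨p, hp, fun i => i.elim0, fun i => i.elim0, fun _ => rfl⟩
  | succ m ih =>
    set p' : (Fin (m + 1) → Sym) → ℝ := fun x => ∑ a, p (Fin.snoc x a) with hp'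
    have hpp (E : (Fin (m + 1) → Sym) → Prop) :
        prob p (fun X => E (Fin.init X)) = prob p' E := by
      rw [prob_eq_sum_snoc, prob_eq_sum_ite]
      refine Finset.sum_congr rfl fun x _ => ?_
      by_cases hE : E x <;> simp [hE, hp']
    obtain ⟨q', hq', hmark, hpair, hlast⟩ := ih p' ⟨fun x => Finset.sum_nonneg fun a _ => hp.1 _, by
      rw [← prob_true, ← hpp, prob_true, hp.2]⟩
    set p1 : Sym → ℝ := fun a => prob p (fun X => X (Fin.last m).castSucc = a) with hp1
    set p2 : Sym → Sym → ℝ := fun a b =>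
      prob p (fun X => X (Fin.last m).castSucc = a ∧ X (Fin.last m).succ = b) with hp2
    have hp10 (a : Sym) : 0 ≤ p1 a := prob_nonneg hp.1 _
    have hp20 (a b : Sym) : 0 ≤ p2 a b := prob_nonneg hp.1 _
    have hsum (a : Sym) : ∑ b, p2 a b = p1 a := sum_prob_and p _ _
    have hle (a b : Sym) (h : p1 a = 0) : p2 a b = 0 :=
      prob_eq_zero_of_le hp.1 (fun X hX => hX.1) h
    have hq1 (a : Sym) : prob q' (fun X => X (Fin.last m) = a) = p1 a := by
      rw [hlast, ← hpp]
      rfl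
    have hq'0 (x : Fin (m + 1) → Sym) (h : p1 (x (Fin.last m)) = 0) : q' x = 0 :=
      le_antisymm (((le_prob hq'.1 (E := fun X => X (Fin.last m) = x (Fin.last m)) rfl).trans_eq
        (hq1 _)).trans_eq h) (hq'.1 x)
    set q : (Fin (m + 2) → Sym) → ℝ := fun X =>
      q' (Fin.init X) * (p2 (X (Fin.last m).castSucc) (X (Fin.last m).succ) /
        p1 (X (Fin.last m).castSucc)) with hq
    have hqs (x : Fin (m + 1) → Sym) (a : Sym) :
        q (Fin.snoc x a) = q' x * (p2 (x (Fin.last m)) a / p1 (x (Fin.last m))) := by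
      simp only [hq, Fin.init_snoc, Fin.snoc_castSucc, Fin.succ_last, Fin.snoc_last]
    have hqinit (E : (Fin (m + 1) → Sym) → Prop) :
        prob q (fun X => E (Fin.init X)) = prob q' E := by
      rw [prob_eq_sum_snoc, prob_eq_sum_ite]
      refine Finset.sum_congr rfl fun x _ => ?_
      simp only [Fin.init_snoc, hqs]
      by_cases hE : E x
      · simp only [hE, if_true]
        rw [← Finset.mul_sum, ← Finset.sum_div, hsum]
        by_cases h0 : p1 (x (Fin.last m)) = 0
        · simp [hq'0 x h0]
        · rw [div_self h0, mul_one]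
      · simp [hE]
    have hqpair (a b : Sym) :
        prob q (fun X => X (Fin.last m).castSucc = a ∧ X (Fin.last m).succ = b) = p2 a b := by
      have : prob q (fun X => X (Fin.last m).castSucc = a ∧ X (Fin.last m).succ = b) =
          prob q' (fun X => X (Fin.last m) = a) * (p2 a b / p1 a) := by
        rw [prob_eq_sum_snoc, prob_eq_sum_ite, Finset.sum_mul]
        refine Finset.sum_congr rfl fun x _ => ?_
        simp only [Fin.succ_last, Fin.snoc_castSucc, Fin.snoc_last, hqs]
        by_cases hx : x (Fin.last m) = a <;> simp [hx]
      rw [this, hq1]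
      by_cases h0 : p1 a = 0
      · simp [h0, hle a b h0]
      · exact mul_div_cancel₀ _ h0
    have hqpairs (i : Fin (m + 1)) (a b : Sym) :
        prob q (fun X => X i.castSucc = a ∧ X i.succ = b) =
          prob p (fun X => X i.castSucc = a ∧ X i.succ = b) := by
      induction i using Fin.lastCases with
      | last => exact hqpair a b
      | cast i =>
        exact (hqinit fun X => X i.castSucc = a ∧ X i.succ = b).trans
          ((hpair i a b).trans (hpp fun X => X i.castSucc = a ∧ X i.succ = b).symm)
    refine ⟨q, ⟨fun X => mul_nonneg (hq'.1 _) (div_nonneg (hp20 _ _) (hp10 _)), ?_⟩, ?_, hqpairs,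
      fun a => ?_⟩
    · rw [← prob_true, hqinit fun _ => True, prob_true, hq'.2]
    · intro i x
      induction i using Fin.lastCases with
      | last =>
        have e1 : (fun X : Fin (m + 2) → Sym => ∀ j ≤ (Fin.last m).succ, X j = x j) =
            fun X => X = x := by
          ext X
          simp [funext_iff, Fin.le_last]
        have e2 : (fun X : Fin (m + 2) → Sym => ∀ j ≤ (Fin.last m).castSucc, X j = x j) =
            fun X => Fin.init X = Fin.init x := by
          ext X
          rw [Fin.forall_fin_succ']
          simp [funext_iff, Fin.init, Fin.le_last]
        have e3 : prob q (fun X => X (Fin.last m).castSucc = x (Fin.last m).castSucc) =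
            p1 (x (Fin.last m).castSucc) := (hqinit fun X => X (Fin.last m) = _).trans (hq1 _)
        rw [e1, e2, e3, prob_eq_single, hqinit fun X => X = Fin.init x, prob_eq_single, hqpair]
        by_cases h0 : p1 (x (Fin.last m).castSucc) = 0
        · simp [h0, hle _ _ h0]
        · simp only [hq]
          rw [mul_assoc, div_mul_cancel₀ _ h0]
      | cast i =>
        have e (k : Fin (m + 1)) :
            (fun X : Fin (m + 2) → Sym => ∀ j ≤ k.castSucc, X j = x j) =
            fun X => ∀ j ≤ k, Fin.init X j = Fin.init x j := by
          ext X
          rw [Fin.forall_fin_succ']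
          have : ¬Fin.last (m + 1) ≤ k.castSucc := (Fin.castSucc_lt_last k).not_ge
          simp [Fin.init, this]
        rw [← Fin.castSucc_succ, e, e, hqinit fun X => ∀ j ≤ i.succ, X j = Fin.init x j,
          hqinit fun X => ∀ j ≤ i.castSucc, X j = Fin.init x j]
        have := hmark i (Fin.init x)
        rw [← hqinit fun X => X i.castSucc = Fin.init x i.castSucc,
          ← hqinit fun X => X i.castSucc = Fin.init x i.castSucc ∧ X i.succ = Fin.init x i.succ]
          at this
        exact this
    · exact prob_pair_congr (i := Fin.last m) (hqpair · ·) fun _ b => b = a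

/-- Only the pair marginals matter: every distribution on admissible inputs is matched by a Markov
chain. -/
lemma exists_mem_inputDistributions (model : Fin m → RelayModel) {p : (Fin (m + 1) → Sym) → ℝ}
    (hp : p ∈ stdSimplex ℝ (Fin (m + 1) → Sym)) (hadm : ∀ x, p x ≠ 0 → Admissible model x) :
    ∃ q ∈ inputDistributions model, minEntropy q = minEntropy p := by
  obtain ⟨q, hq, hmark, hpair, hlast⟩ := exists_isMarkovChain p hp
  refine ⟨q, ⟨hq, fun x hx i hi hN => ?_, hmark⟩, ?_⟩
  · have h1 : 0 < prob q (fun X => X i.castSucc = x i.castSucc ∧ X i.succ = x i.succ) :=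
      ((hq.1 x).lt_of_ne' hx).trans_le (le_prob hq.1 ⟨rfl, rfl⟩)
    rw [hpair] at h1
    obtain ⟨x', hx', h2, h3⟩ := exists_of_prob_ne_zero h1.ne'
    exact hadm x' hx' i hi ⟨h2 ▸ hN.1, h3 ▸ hN.2⟩
  · unfold minEntropy
    congr 1
    funext k
    cases k with
    | none => simp only [entropy, sinkOutput, hlast]
    | some i =>
      have h1 (b : Sym) := prob_pair_congr (hpair i) fun _ b' => b' = b
      have h2 (b y : Sym) : prob q (fun X => X i.succ = b ∧ relayOutput X i = y) =
          prob p (fun X => X i.succ = b ∧ relayOutput X i = y) :=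
        prob_pair_congr (hpair i) fun a' b' => b' = b ∧
          (match b' with | none => a' | some c => some c : Sym) = y
      simp only [condEntropy, h1, h2]

end Markov

/-! ### The converse -/

section Converse

variable {α β : Type*} [Fintype α]

/-- The product of the conditional weights `q(y_t | x_t)`, where `x_t` is a function `f t` of the
past of `y`, is a sub-probability on the words `y`. -/
lemma sum_prod_causal_le_one {n : ℕ} (q : β → α → ℝ) (hq : ∀ b a, 0 ≤ q b a)
    (hq1 : ∀ b, ∑ a, q b a ≤ 1) (f : (t : Fin n) → (Fin t.val → α) → β) :
    ∑ y : Fin n → α, ∏ t : Fin n, q (f t fun s => y ⟨s.val, s.isLt.trans t.isLt⟩) (y t) ≤ 1 := by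
  induction n with
  | zero => simp
  | succ n ih =>
    rw [← (Fin.snocEquiv fun _ => α).sum_comp, Fintype.sum_prod_type, Finset.sum_comm]
    refine le_trans (Finset.sum_le_sum fun y _ => ?_) (ih fun t => f t.castSucc)
    have h (a : α) (t : Fin n) : (fun s : Fin t.val =>
        (Fin.snoc y a : Fin (n + 1) → α) ⟨s.val, s.isLt.trans t.castSucc.isLt⟩) =
        fun s => y ⟨s.val, s.isLt.trans t.isLt⟩ :=
      funext fun s => Fin.snoc_castSucc (α := fun _ => α) a y ⟨s.val, s.isLt.trans t.isLt⟩
    have h' (a : α) : (fun s : Fin n =>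
        (Fin.snoc y a : Fin (n + 1) → α) ⟨s.val, s.isLt.trans (Fin.last n).isLt⟩) = y :=
      funext fun s => Fin.snoc_castSucc (α := fun _ => α) a y s
    have key (a : α) : (∏ t : Fin (n + 1), q (f t fun s =>
        (Fin.snoc y a : Fin (n + 1) → α) ⟨s.val, s.isLt.trans t.isLt⟩)
          ((Fin.snoc y a : Fin (n + 1) → α) t)) =
        (∏ t : Fin n, q (f t.castSucc fun s => y ⟨s.val, s.isLt.trans t.isLt⟩) (y t)) *
          q (f (Fin.last n) y) a := by
      rw [Fin.prod_univ_castSucc]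
      congr 1
      · refine Finset.prod_congr rfl fun t _ => ?_
        rw [Fin.snoc_castSucc (α := fun _ => α)]
        exact congrArg (fun g => q (f t.castSucc g) (y t)) (h a t)
      · rw [Fin.snoc_last]
        exact congrArg (fun g => q (f (Fin.last n) g) a) (h' a)
    refine (Finset.sum_congr rfl fun a _ => key a).trans_le ?_
    rw [← Finset.mul_sum]
    exact mul_le_of_le_one_right (Finset.prod_nonneg fun _ _ => hq _ _) (hq1 _)

/-- A counting form of the cut-set bound. If distinct messages give distinct words `y w`, and `x w`
is a causal function of `y w`, then `log₂ M ≤ n H(Y | X)` for the empirical distribution over all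
messages and times: compare the uniform distribution on the words with the distribution
`∏ q(y_t | x_t)`, where `q` is the empirical conditional distribution. -/
lemma logb_le_mul_condEntropy_empirical {Ω : Type*} [Fintype Ω] [Fintype β] {n M : ℕ} (hn : 0 < n)
    (hM : 0 < M) (z : Fin M × Fin n → Ω) (Y : Ω → α) (X : Ω → β)
    (f : (t : Fin n) → (Fin t.val → α) → β)
    (hf : ∀ w t, X (z (w, t)) = f t fun s => Y (z (w, ⟨s.val, s.isLt.trans t.isLt⟩)))
    (hinj : Function.Injective fun w t => Y (z (w, t))) :
    Real.logb 2 M ≤ n * condEntropy (empirical z) Y X := by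
  have : Nonempty (Fin M × Fin n) := ⟨⟨⟨0, hM⟩, ⟨0, hn⟩⟩⟩
  set q : β → α → ℝ := fun b a => (freq fun i => X (z i) = b ∧ Y (z i) = a : ℕ) /
    (freq fun i => X (z i) = b : ℕ) with hq
  have hq0 (b : β) (a : α) : 0 ≤ q b a := by positivity
  have hq1 (b : β) : ∑ a, q b a ≤ 1 := by
    rw [← Finset.sum_div, sum_freq_and]
    exact div_self_le_one _
  set Q : Fin M → ℝ := fun w => ∏ t, q (X (z (w, t))) (Y (z (w, t))) with hQ
  have hqpos (w : Fin M) (t : Fin n) : 0 < q (X (z (w, t))) (Y (z (w, t))) :=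
    div_pos (Nat.cast_pos.2 (freq_pos (i := (w, t)) ⟨rfl, rfl⟩))
      (Nat.cast_pos.2 (freq_pos (i := (w, t)) rfl))
  have hQpos (w : Fin M) : 0 < Q w := Finset.prod_pos fun t _ => hqpos w t
  have hQsum : ∑ w, Q w ≤ 1 := by
    refine le_trans ?_ (sum_prod_causal_le_one q hq0 hq1 f)
    have : ∀ w, Q w = (fun y : Fin n → α =>
        ∏ t : Fin n, q (f t fun s => y ⟨s.val, s.isLt.trans t.isLt⟩) (y t))
          (fun t => Y (z (w, t))) := fun w => Finset.prod_congr rfl fun t _ => by rw [hf]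
    rw [Finset.sum_congr rfl fun w _ => this w]
    classical
    rw [← Finset.sum_image (f := fun y : Fin n → α =>
      ∏ t : Fin n, q (f t fun s => y ⟨s.val, s.isLt.trans t.isLt⟩) (y t)) hinj.injOn]
    exact Finset.sum_le_sum_of_subset_of_nonneg (Finset.subset_univ _)
      fun y _ _ => Finset.prod_nonneg fun _ _ => hq0 _ _
  have hMR : (0 : ℝ) < M := Nat.cast_pos.2 hM
  -- Gibbs' inequality, from `log u ≤ u - 1` at `u = M * Q w`
  have hlog : M * Real.log M + ∑ w, Real.log (Q w) ≤ 0 := by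
    have h1 (w : Fin M) : Real.log M + Real.log (Q w) ≤ M * Q w - 1 := by
      rw [← Real.log_mul hMR.ne' (hQpos w).ne']
      exact Real.log_le_sub_one_of_pos (mul_pos hMR (hQpos w))
    have h2 := Finset.sum_le_sum fun w (_ : w ∈ Finset.univ) => h1 w
    simp only [Finset.sum_add_distrib, Finset.sum_sub_distrib, ← Finset.mul_sum,
      Finset.sum_const, Finset.card_univ, Fintype.card_fin, nsmul_eq_mul, mul_one] at h2
    nlinarith
  have hH := card_mul_condEntropy_empirical_eq_sum z Y X
  have hsum : ∑ i, Real.logb 2 (q (X (z i)) (Y (z i))) = (∑ w, Real.log (Q w)) / Real.log 2 := by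
    rw [Fintype.sum_prod_type, Finset.sum_div]
    refine Finset.sum_congr rfl fun w _ => ?_
    rw [hQ, Real.log_prod fun t _ => (hqpos w t).ne', Finset.sum_div]
    rfl
  rw [hsum, Fintype.card_prod, Fintype.card_fin, Fintype.card_fin] at hH
  push_cast at hH
  have h2 : 0 < Real.log 2 := Real.log_pos one_lt_two
  have : M * Real.logb 2 M ≤ M * (n * condEntropy (empirical z) Y X) := by
    rw [← mul_assoc, hH, Real.logb, ← neg_div, ← mul_div_assoc]
    gcongr
    linarith
  exact le_of_mul_le_mul_left this hMR

variable {m n M : ℕ}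

lemma Code.inputs_succ (c : Code m n M) (w : Fin M) (t : Fin n) (i : Fin m) :
    c.inputs w t i.succ =
      c.relay i t fun s => relayOutput (c.inputs w ⟨s.val, s.isLt.trans t.isLt⟩) i := by
  rw [Code.inputs, Fin.cons_succ]

lemma Code.inputs_zero (c : Code m n M) (w : Fin M) (t : Fin n) :
    c.inputs w t 0 = c.source w t := by
  rw [Code.inputs, Fin.cons_zero]

/-- What a relay sends is a causal function of what it receives. -/
lemma Code.inputs_succ_congr (c : Code m n M) {w w' : Fin M} {i : Fin m} {t : Fin n}
    (h : ∀ s < t, relayOutput (c.inputs w s) i = relayOutput (c.inputs w' s) i) :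
    c.inputs w t i.succ = c.inputs w' t i.succ := by
  rw [c.inputs_succ, c.inputs_succ]
  congr 1
  exact funext fun s => h _ s.isLt

lemma relayOutput_congr {x x' : Fin (m + 1) → Sym} {i : Fin m}
    (h1 : x i.castSucc = x' i.castSucc) (h2 : x i.succ = x' i.succ) :
    relayOutput x i = relayOutput x' i := by
  rw [relayOutput, relayOutput, h1, h2]

/-- In a zero-error code the word sent by any node determines the message, because it determines
the words sent by all later nodes. -/
lemma Code.IsZeroError.inputs_injective {model : Fin m → RelayModel} {c : Code m n M}
    (hc : c.IsZeroError model) (j : Fin (m + 1)) :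
    Function.Injective fun w t => c.inputs w t j := by
  intro w w' h
  replace h : ∀ t, c.inputs w t j = c.inputs w' t j := congrFun h
  induction j using Fin.reverseInduction with
  | last =>
    rw [← (hc w).2, ← (hc w').2]
    exact congrArg c.decode (funext h)
  | cast i ih =>
    refine ih fun t => ?_
    induction t using WellFoundedLT.induction with
    | ind t iht => exact c.inputs_succ_congr fun s hs => relayOutput_congr (h s) (iht s hs)

lemma Code.IsZeroError.relayOutput_injective {model : Fin m → RelayModel} {c : Code m n M}
    (hc : c.IsZeroError model) (i : Fin m) :
    Function.Injective fun w t => relayOutput (c.inputs w t) i := fun _ _ h =>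
  hc.inputs_injective i.succ (funext fun _ => c.inputs_succ_congr fun s _ => congrFun h s)

/-- The converse: the Markov chain with the pair laws of the empirical distribution of the inputs
over all messages and times bounds the rate of a code. -/
lemma exists_le_minEntropy {model : Fin m → RelayModel} {R : ℝ} (hR : R ∈ zeroErrorRates model) :
    ∃ p ∈ inputDistributions model, R ≤ minEntropy p := by
  obtain ⟨n, M, hn, ⟨c, hc⟩, rfl⟩ := hR
  have hM : 0 < M := Fin.pos (c.decode fun _ => none)
  have : Nonempty (Fin M × Fin n) := ⟨⟨⟨0, hM⟩, ⟨0, hn⟩⟩⟩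
  set z : Fin M × Fin n → Fin (m + 1) → Sym := fun i => c.inputs i.1 i.2 with hz
  have hp := empirical_mem_stdSimplex z
  obtain ⟨q, hq, hqp⟩ := exists_mem_inputDistributions model hp fun x hx => by
    obtain ⟨i, rfl⟩ := exists_of_empirical_ne_zero hx
    exact (hc i.1).1 i.2
  have hn' : (0 : ℝ) < n := Nat.cast_pos.2 hn
  refine ⟨q, hq, ?_⟩
  rw [hqp, le_minEntropy_iff hp]
  refine ⟨fun i => ?_, ?_⟩
  · rw [div_le_iff₀' hn']
    exact logb_le_mul_condEntropy_empirical hn hM z _ _ (c.relay i)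
      (fun w t => c.inputs_succ w t i) (hc.relayOutput_injective i)
  · rw [div_le_iff₀' hn']
    exact logb_le_mul_condEntropy_empirical hn hM z _ _ (fun _ _ => ()) (fun _ _ => rfl)
      (hc.inputs_injective (Fin.last m))

end Converse

/-! ### Codes from causal trajectories -/

section Trajectory

variable {m n : ℕ}

/-- To give a zero-error code it suffices to say what all nodes send for each message, provided that
what a relay sends is determined by what it received before, and that the sink receives different
words for different messages. -/
lemma mem_zeroErrorRates_of_causal {model : Fin m → RelayModel} {W : Type*} [Fintype W] [Nonempty W]
    (hn : 0 < n) (x : W → Fin n → Fin (m + 1) → Sym) (hadm : ∀ w t, Admissible model (x w t))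
    (hcausal : ∀ (i : Fin m) (t : Fin n) (w w' : W),
      (∀ s < t, relayOutput (x w s) i = relayOutput (x w' s) i) → x w t i.succ = x w' t i.succ)
    (hinj : Function.Injective fun w t => sinkOutput (x w t)) :
    Real.logb 2 (Fintype.card W) / n ∈ zeroErrorRates model := by
  classical
  let e := Fintype.equivFin W
  let c : Code m n (Fintype.card W) :=
    { source := fun w t => x (e.symm w) t 0
      relay := fun i t y =>
        if h : ∃ w, ∀ s : Fin t.val, relayOutput (x w ⟨s.val, s.isLt.trans t.isLt⟩) i = y s then
          x h.choose t i.succ else none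
      decode := fun y => e (Function.invFun (fun w t => sinkOutput (x w t)) y) }
  have hc (w : Fin (Fintype.card W)) (t : Fin n) : c.inputs w t = x (e.symm w) t := by
    induction t using WellFoundedLT.induction with
    | ind t ih =>
      funext j
      cases j using Fin.cases with
      | zero => exact c.inputs_zero w t
      | succ i =>
        have hex : ∃ w', ∀ s : Fin t.val, relayOutput (x w' ⟨s.val, s.isLt.trans t.isLt⟩) i =
            relayOutput (c.inputs w ⟨s.val, s.isLt.trans t.isLt⟩) i :=
          ⟨e.symm w, fun s => by rw [ih _ s.isLt]⟩
        rw [c.inputs_succ]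
        simp only [c]
        rw [dif_pos hex]
        refine hcausal i t _ _ fun s hs => ?_
        rw [← ih s hs]
        exact hex.choose_spec ⟨s.val, hs⟩
  refine ⟨n, Fintype.card W, hn, ⟨c, fun w => ⟨fun t => hc w t ▸ hadm _ t, ?_⟩⟩, rfl⟩
  simp only [hc]
  simp only [c]
  rw [Function.leftInverse_invFun hinj, Equiv.apply_symm_apply]

end Trajectory

/-! ### Permutations of a word with prescribed stabilized word -/

section Perm

open Equiv

variable {ι α β : Type*} [Fintype ι] [DecidableEq ι] [DecidableEq α] [DecidableEq β]

/-- The rearrangements of the word `y` by permutations that preserve the word `x`. -/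
def rearrangements (y : ι → α) (x : ι → β) : Finset (ι → α) :=
  Finset.univ.image fun τ : {τ : Perm ι // x ∘ τ = x} => y ∘ τ.1

lemma card_rearrangements_pos (y : ι → α) (x : ι → β) : 0 < (rearrangements y x).card :=
  Finset.card_pos.2 ⟨_, Finset.mem_image_of_mem _
    (Finset.mem_univ (⟨1, rfl⟩ : {τ : Perm ι // x ∘ τ = x}))⟩

/-- Up to `|rearrangements y x|` messages can be encoded in rearrangements of `y` that leave `x`
unchanged. -/
lemma exists_perms {M : ℕ} {y : ι → α} {x : ι → β} (hM : M ≤ (rearrangements y x).card) :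
    ∃ τ : Fin M → Perm ι, (∀ k, x ∘ τ k = x) ∧ Function.Injective fun k => y ∘ τ k := by
  obtain ⟨g⟩ := Function.Embedding.nonempty_of_card_le
    (α := Fin M) (β := rearrangements y x) (by simpa using hM)
  have h (k : Fin M) : ∃ τ : Perm ι, x ∘ τ = x ∧ y ∘ τ = g k := by
    obtain ⟨τ, -, hτ⟩ := Finset.mem_image.1 (g k).2
    exact ⟨τ.1, τ.2, hτ⟩
  choose τ hτ hτ' using h
  exact ⟨τ, hτ, fun k k' h => g.injective (Subtype.ext (by simpa [hτ'] using h))⟩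

variable [Fintype α] [Fintype β]

lemma card_stabilizer_eq_prod (x : ι → β) :
    Fintype.card {τ : Perm ι // x ∘ τ = x} = ∏ b, (freq fun i => x i = b).factorial := by
  rw [DomMulAct.stabilizer_card]
  refine Finset.prod_congr rfl fun b _ => ?_
  rw [Fintype.card_subtype, freq]
  congr!

/-- Two permutations that rearrange `y` in the same way differ by a permutation preserving `y`. -/
lemma prod_factorial_le_card_rearrangements (y : ι → α) (x : ι → β) :
    ∏ b, (freq fun i => x i = b).factorial ≤
      (∏ b, ∏ a, (freq fun i => x i = b ∧ y i = a).factorial) * (rearrangements y x).card := by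
  have h2 : ∏ b, ∏ a, (freq fun i => x i = b ∧ y i = a).factorial =
      Fintype.card {τ : Perm ι // (fun i => (x i, y i)) ∘ τ = fun i => (x i, y i)} := by
    rw [card_stabilizer_eq_prod, Fintype.prod_prod_type]
    simp only [Prod.mk.injEq]
  rw [h2, ← card_stabilizer_eq_prod, ← Finset.card_univ (α := {τ : Perm ι // x ∘ τ = x})]
  refine Finset.card_le_mul_card_image _ _ fun y' hy' => ?_
  obtain ⟨τ₀, -, rfl⟩ := Finset.mem_image.1 hy'
  rw [← Finset.card_univ]
  have hmem (τ : {τ : Perm ι // x ∘ τ = x}) (h : y ∘ τ.1 = y ∘ τ₀.1) :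
      (fun i => (x i, y i)) ∘ (τ.1 * τ₀.1⁻¹ : Perm ι) = fun i => (x i, y i) := by
    funext i
    have h1 := congrFun τ.2 (τ₀.1⁻¹ i)
    have h2 := congrFun τ₀.2 (τ₀.1⁻¹ i)
    have h3 := congrFun h (τ₀.1⁻¹ i)
    simp only [Function.comp_apply, ← Perm.mul_apply, mul_inv_cancel, Perm.one_apply] at h1 h2 h3
    simp only [Function.comp_apply, Prod.mk.injEq]
    exact ⟨h1.trans h2.symm, h3⟩
  refine Finset.card_le_card_of_injOn
    (fun τ => if h : y ∘ τ.1 = y ∘ τ₀.1 then ⟨τ.1 * τ₀.1⁻¹, hmem τ h⟩ else ⟨1, rfl⟩)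
    (fun _ _ => Finset.mem_coe.2 (Finset.mem_univ _)) ?_
  intro τ hτ τ' hτ' h
  have hτ := (Finset.mem_filter.1 (Finset.mem_coe.1 hτ)).2
  have hτ' := (Finset.mem_filter.1 (Finset.mem_coe.1 hτ')).2
  simp only [dif_pos hτ, dif_pos hτ', Subtype.mk.injEq, mul_left_inj] at h
  exact Subtype.ext h

lemma le_log_factorial (n : ℕ) : n * Real.log n - n ≤ Real.log n.factorial := by
  rcases eq_or_ne n 0 with rfl | hn
  · simp
  · have h := Stirling.le_log_factorial_stirling hn
    have h1 : 0 ≤ Real.log n := Real.log_natCast_nonneg n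
    have h2 : 0 ≤ Real.log (2 * Real.pi) := Real.log_nonneg (by linarith [Real.pi_gt_three])
    linarith

lemma log_factorial_le (n : ℕ) :
    Real.log n.factorial ≤ n * Real.log n - n + (Real.log (n + 1) + 1) := by
  have h1 (n : ℕ) : Real.log n.factorial ≤ (n + 1) * Real.log (n + 1) - n := by
    induction n with
    | zero => simp
    | succ n ih =>
      have hpos : (0 : ℝ) < n + 1 := by positivity
      have h := Real.one_sub_inv_le_log_of_pos (x := (n + 2 : ℝ) / (n + 1)) (by positivity)
      rw [Real.log_div (by positivity) hpos.ne', inv_div] at h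
      have h' : 1 ≤ (n + 2) * (Real.log (n + 2) - Real.log (n + 1)) := by
        have := mul_le_mul_of_nonneg_left h (by positivity : (0 : ℝ) ≤ n + 2)
        rwa [mul_sub, mul_div_cancel₀ _ (by positivity), mul_one,
          show (n + 2 : ℝ) - (n + 1) = 1 by ring] at this
      rw [Nat.factorial_succ, Nat.cast_mul, Real.log_mul (by positivity) (by positivity)]
      push_cast
      rw [show (n + 1 + 1 : ℝ) = n + 2 by ring]
      nlinarith
  rcases Nat.eq_zero_or_pos n with rfl | hn
  · simp
  · have hn' : (0 : ℝ) < n := Nat.cast_pos.2 hn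
    have h := Real.log_le_sub_one_of_pos (x := (n + 1 : ℝ) / n) (by positivity)
    rw [Real.log_div (by positivity) hn'.ne'] at h
    have h' := mul_le_mul_of_nonneg_left h hn'.le
    rw [mul_sub, mul_sub, mul_div_cancel₀ _ hn'.ne'] at h'
    linarith [h1 n]

/-- The number of rearrangements is `2 ^ (K H(Y | X))`, up to a factor polynomial in `K`. -/
lemma mul_condEntropy_sub_le_logb_card {Ω : Type*} [Fintype Ω] [Nonempty ι] (z : ι → Ω)
    (Y : Ω → α) (X : Ω → β) :
    Fintype.card ι * condEntropy (empirical z) Y X -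
        Fintype.card β * Fintype.card α * (Real.log (Fintype.card ι + 1) + 1) / Real.log 2 ≤
      Real.logb 2 (rearrangements (fun i => Y (z i)) fun i => X (z i)).card := by
  set N := (rearrangements (fun i => Y (z i)) fun i => X (z i)).card with hN
  have hl2 : 0 < Real.log 2 := Real.log_pos one_lt_two
  have hNpos : 0 < N := card_rearrangements_pos _ _
  set nb : β → ℕ := fun b => freq fun i => X (z i) = b with hnb
  set nab : β → α → ℕ := fun b a => freq fun i => X (z i) = b ∧ Y (z i) = a with hnab
  have hle : ∏ b, (nb b).factorial ≤ (∏ b, ∏ a, (nab b a).factorial) * N :=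
    prod_factorial_le_card_rearrangements _ _
  have hlog : ∑ b, Real.log (nb b).factorial ≤
      ∑ b, ∑ a, Real.log (nab b a).factorial + Real.log N := by
    have h := Real.log_le_log (by positivity) (Nat.cast_le (α := ℝ).2 hle)
    push_cast at h
    rw [Real.log_mul (by positivity) (by positivity), Real.log_prod fun b _ => by positivity,
      Real.log_prod fun b _ => by positivity] at h
    refine h.trans_eq ?_
    congr 1
    exact Finset.sum_congr rfl fun b _ => Real.log_prod fun a _ => by positivity
  have hsum (b : β) : ∑ a, (nab b a : ℝ) = nb b := sum_freq_and _ _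
  have hterm (b : β) :
      ∑ a, Real.log (nab b a).factorial - Real.log (nb b).factorial ≤
        ∑ a, nab b a * Real.log (nab b a / nb b) +
          Fintype.card α * (Real.log (Fintype.card ι + 1) + 1) := by
    have h1 : ∑ a, Real.log (nab b a).factorial ≤ ∑ a, (nab b a * Real.log (nab b a) - nab b a +
        (Real.log (Fintype.card ι + 1) + 1)) := Finset.sum_le_sum fun a _ => by
      refine (log_factorial_le _).trans ?_
      have : nab b a ≤ Fintype.card ι := freq_le_card _
      gcongr
    have h2 : ∑ a, nab b a * Real.log (nab b a / nb b) =
        ∑ a, nab b a * Real.log (nab b a) - nb b * Real.log (nb b) := by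
      rw [← hsum b, Finset.sum_mul, ← Finset.sum_sub_distrib, hsum b]
      refine Finset.sum_congr rfl fun a _ => ?_
      rcases Nat.eq_zero_or_pos (nab b a) with h | h
      · simp [h]
      · have h' : nb b ≠ 0 := by
          rintro h0
          have := hsum b
          rw [h0, Nat.cast_zero, Finset.sum_eq_zero_iff_of_nonneg fun _ _ => by positivity] at this
          exact h.ne' (Nat.cast_eq_zero.1 (this a (Finset.mem_univ _)))
        rw [Real.log_div (by positivity) (by positivity), mul_sub]
    rw [Finset.sum_add_distrib, Finset.sum_sub_distrib, hsum, Finset.sum_const, Finset.card_univ,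
      nsmul_eq_mul] at h1
    linarith [le_log_factorial (nb b)]
  have htot := Finset.sum_le_sum fun b (_ : b ∈ Finset.univ) => hterm b
  rw [Finset.sum_sub_distrib, Finset.sum_add_distrib, Finset.sum_const, Finset.card_univ,
    nsmul_eq_mul] at htot
  have hH : Fintype.card ι * condEntropy (empirical z) Y X =
      -(∑ b, ∑ a, nab b a * Real.log (nab b a / nb b)) / Real.log 2 := by
    rw [card_mul_condEntropy_empirical, neg_div, Finset.sum_div]
    congr 1
    refine Finset.sum_congr rfl fun b _ => ?_
    rw [Finset.sum_div]
    exact Finset.sum_congr rfl fun a _ => (mul_div_assoc _ _ _).symm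
  rw [hH, Real.logb, ← sub_div]
  gcongr
  linarith

end Perm

/-! ### Block Markov superposition coding -/

section Block

open Equiv

variable {m K M : ℕ}

/-- The permutation of the base word that node `j` applies in block `b`, when the message stream is
`v`: it refines the permutation applied by node `j + 1` by a factor that encodes
the block message `v (b + (m - j))`, which node `j + 1` is to learn in this block. -/
def blockPerm (τ : Fin m → Fin M → Perm (Fin K)) (τs : Fin M → Perm (Fin K)) (v : ℕ → Fin M)
    (b : ℕ) (j : Fin (m + 1)) : Perm (Fin K) :=
  Fin.reverseInduction (motive := fun _ => Perm (Fin K)) (τs (v b))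
    (fun i σ => τ i (v (b + (m - i))) * σ) j

variable {τ : Fin m → Fin M → Perm (Fin K)} {τs : Fin M → Perm (Fin K)}

lemma blockPerm_last (v : ℕ → Fin M) (b : ℕ) : blockPerm τ τs v b (Fin.last m) = τs (v b) := by
  rw [blockPerm, Fin.reverseInduction_last]

lemma blockPerm_castSucc (v : ℕ → Fin M) (b : ℕ) (i : Fin m) :
    blockPerm τ τs v b i.castSucc = τ i (v (b + (m - i))) * blockPerm τ τs v b i.succ := by
  rw [blockPerm, Fin.reverseInduction_castSucc, blockPerm]

lemma blockPerm_congr {v v' : ℕ → Fin M} {b : ℕ} {j : Fin (m + 1)}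
    (h : ∀ k ≤ b + (m - j), v k = v' k) : blockPerm τ τs v b j = blockPerm τ τs v' b j := by
  induction j using Fin.reverseInduction with
  | last => rw [blockPerm_last, blockPerm_last, h b (by omega)]
  | cast i ih =>
    rw [blockPerm_castSucc, blockPerm_castSucc, ih fun k hk => h k ?_, h _ (by simp)]
    simp only [Fin.val_succ, Fin.val_castSucc] at hk ⊢
    omega

/-- The message stream of a message `w` of `B - m` block messages. The first `m` entries are known
to all nodes in advance. -/
def messageStream {B : ℕ} (d : Fin M) (w : Fin (B - m) → Fin M) (k : ℕ) : Fin M :=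
  if h : m ≤ k ∧ k < B then w ⟨k - m, by omega⟩ else d

/-- A base word `z` of admissible inputs and permutations `τ` encoding `M` block messages in each
hop give codes with `B` blocks that carry `B - m` block messages. -/
lemma mem_zeroErrorRates_of_perms {model : Fin m → RelayModel} (hK : 0 < K) (hM : 0 < M)
    (z : Fin K → Fin (m + 1) → Sym) (hz : ∀ t, Admissible model (z t))
    (hτ : ∀ i k, (fun t => z t i.succ) ∘ τ i k = fun t => z t i.succ)
    (hτinj : ∀ i, Function.Injective fun k => (fun t => relayOutput (z t) i) ∘ τ i k)
    (hτs : Function.Injective fun k => (fun t => sinkOutput (z t)) ∘ τs k) {B : ℕ} (hB : 0 < B) :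
    (B - m : ℕ) * Real.logb 2 M / (B * K : ℕ) ∈ zeroErrorRates model := by
  have : Nonempty (Fin M) := ⟨⟨0, hM⟩⟩
  set v : (Fin (B - m) → Fin M) → ℕ → Fin M := messageStream ⟨0, hM⟩ with hv
  set x : (Fin (B - m) → Fin M) → Fin (B * K) → Fin (m + 1) → Sym := fun w t j =>
    z (blockPerm τ τs (v w) t.divNat j t.modNat) j with hx
  have hsucc (w : Fin (B - m) → Fin M) (t : Fin (B * K)) (i : Fin m) : x w t i.succ =
      z (blockPerm τ τs (v w) t.divNat i.castSucc t.modNat) i.succ := by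
    simp only [hx, blockPerm_castSucc, Perm.mul_apply]
    exact (congrFun (hτ i _) _).symm
  have hout (w : Fin (B - m) → Fin M) (t : Fin (B * K)) (i : Fin m) : relayOutput (x w t) i =
      relayOutput (z (blockPerm τ τs (v w) t.divNat i.castSucc t.modNat)) i :=
    relayOutput_congr rfl (hsucc w t i)
  have hdm (b : Fin B) (s : Fin K) :
      (finProdFinEquiv (b, s)).divNat = b ∧ (finProdFinEquiv (b, s)).modNat = s := by
    have := finProdFinEquiv.symm_apply_apply (b, s)
    exact ⟨congrArg Prod.fst this, congrArg Prod.snd this⟩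
  -- a relay that has received `b` blocks knows the stream up to its own position in block `b`
  have hknow (i : Fin m) (w w' : Fin (B - m) → Fin M) (b : ℕ) (hb : b ≤ B)
      (h : ∀ t : Fin (B * K), t.divNat.val < b →
        relayOutput (x w t) i = relayOutput (x w' t) i) :
      ∀ k < b + (m - i), v w k = v w' k := by
    induction b with
    | zero =>
      intro k hk
      have : ¬(m ≤ k ∧ k < B) := by omega
      simp only [hv, messageStream, dif_neg this]
    | succ b ih =>
      have ih := ih (by omega) fun t ht => h t (by omega)
      have hσ : blockPerm τ τs (v w) b i.succ = blockPerm τ τs (v w') b i.succ :=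
        blockPerm_congr fun k hk => ih k (by
          simp only [Fin.val_succ] at hk
          have := i.isLt
          omega)
      have hnew : v w (b + (m - i)) = v w' (b + (m - i)) := by
        refine hτinj i (funext fun u => ?_)
        have ht := hdm ⟨b, hb⟩ ((blockPerm τ τs (v w) b i.succ)⁻¹ u)
        have hu := h (finProdFinEquiv (⟨b, hb⟩, (blockPerm τ τs (v w) b i.succ)⁻¹ u))
          (by rw [ht.1]; exact b.lt_succ_self)
        rw [hout, hout, ht.1, ht.2, blockPerm_castSucc, blockPerm_castSucc, ← hσ, Perm.mul_apply,
          Perm.mul_apply, ← Perm.mul_apply _ (_)⁻¹, mul_inv_cancel, Perm.one_apply] at hu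
        exact hu
      intro k hk
      rcases (show k < b + (m - i) ∨ k = b + (m - i) by omega) with hk | rfl
      exacts [ih k hk, hnew]
  have hrate := mem_zeroErrorRates_of_causal (model := model) (Nat.mul_pos hB hK) x ?_ ?_ ?_
  · simpa [Real.logb_pow] using hrate
  · intro w t i hi hN
    rw [hsucc] at hN
    exact hz _ i hi hN
  · intro i t w w' h
    have hk := hknow i w w' t.divNat t.divNat.isLt.le fun s hs => h s (by
      rw [Fin.lt_def] at *
      by_contra! hts
      exact absurd hs (not_lt.2 (Nat.div_le_div_right hts)))
    simp only [hx]
    rw [blockPerm_congr fun k hk' => hk k _]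
    intro k hk'
    simp only [Fin.val_succ] at hk'
    have := i.isLt
    omega
  · intro w w' h
    have hvv (b : Fin B) : v w b = v w' b := by
      refine hτs (funext fun u => ?_)
      have := congrFun h (finProdFinEquiv (b, u))
      simp only [sinkOutput, hx, hdm, blockPerm_last] at this
      exact this
    funext k
    have := hvv ⟨k + m, by omega⟩
    have hk : m ≤ k.val + m ∧ k.val + m < B := by omega
    simpa only [hv, messageStream, dif_pos hk, Nat.add_sub_cancel] using this

end Block

open Filter Topology

/-! ### Achievability -/

/-- Every distribution is a limit of empirical distributions of words with letters in its support:
take about `p ω * L` copies of each letter `ω`. -/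
lemma exists_tendsto_empirical {Ω : Type*} [Fintype Ω] {p : Ω → ℝ} (hp : p ∈ stdSimplex ℝ Ω) :
    ∃ (K : ℕ → ℕ) (z : (L : ℕ) → Fin (K L) → Ω), Tendsto K atTop atTop ∧
      (∀ L t, p (z L t) ≠ 0) ∧ Tendsto (fun L => empirical (z L)) atTop (𝓝 p) := by
  classical
  set c : ℕ → Ω → ℕ := fun L ω => ⌊p ω * L⌋₊ with hc
  set K : ℕ → ℕ := fun L => ∑ ω, c L ω with hK
  let e (L : ℕ) : (Σ ω, Fin (c L ω)) ≃ Fin (K L) :=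
    Fintype.equivFinOfCardEq (by simp [hK])
  set z : (L : ℕ) → Fin (K L) → Ω := fun L t => ((e L).symm t).1 with hz
  have hfreq (L : ℕ) (ω : Ω) : ((freq fun t => z L t = ω : ℕ) : ℝ) = c L ω := by
    rw [freq_eq_sum, ← (e L).sum_comp, Fintype.sum_sigma, Finset.sum_eq_single ω]
    · simp [hz]
    · intro ω' _ h
      simp [hz, h]
    · simp
  have hclim (ω : Ω) : Tendsto (fun L : ℕ => (c L ω : ℝ) / L) atTop (𝓝 (p ω)) :=
    (tendsto_nat_floor_mul_div_atTop (hp.1 ω)).comp tendsto_natCast_atTop_atTop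
  have hKlim : Tendsto (fun L : ℕ => (K L : ℝ) / L) atTop (𝓝 1) := by
    have := tendsto_finsetSum Finset.univ fun ω (_ : ω ∈ Finset.univ) => hclim ω
    rw [hp.2] at this
    refine this.congr fun L => ?_
    rw [← Finset.sum_div, ← Nat.cast_sum]
  refine ⟨K, z, ?_, fun L t h => ?_, ?_⟩
  · rw [← tendsto_natCast_atTop_iff (R := ℝ)]
    refine (hKlim.pos_mul_atTop one_pos tendsto_natCast_atTop_atTop).congr' ?_
    filter_upwards [eventually_ne_atTop 0] with L hL
    exact div_mul_cancel₀ _ (Nat.cast_ne_zero.2 hL)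
  · have := Fin.pos ((e L).symm t).2
    simp only [hz] at h
    simp [hc, h] at this
  · rw [tendsto_pi_nhds]
    intro ω
    have := (hclim ω).div hKlim one_ne_zero
    rw [div_one] at this
    refine this.congr' ?_
    filter_upwards [eventually_ne_atTop 0] with L hL
    rw [Pi.div_apply, div_div_div_cancel_right₀ (Nat.cast_ne_zero.2 hL), empirical, hfreq,
      Fintype.card_fin]

lemma tendsto_log_succ_add_one_div :
    Tendsto (fun K : ℕ => (Real.log (K + 1) + 1) / K) atTop (𝓝 0) := by
  have h1 := (Real.tendsto_pow_log_div_mul_add_atTop 1 (-1) 1 one_ne_zero).comp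
    (tendsto_atTop_add_const_right atTop (1 : ℝ) (tendsto_natCast_atTop_atTop (R := ℝ)))
  have h2 := h1.add (tendsto_const_div_atTop_nhds_zero_nat (1 : ℝ))
  rw [add_zero] at h2
  refine h2.congr fun K => ?_
  simp [add_div]

variable {m : ℕ}

/-- Achievability, phrased through an upper bound `C` of the rates: the rates of the block codes
built from a long word that is nearly `p`-distributed tend, as the number of blocks grows, to a
limit that is at least `R`. -/
lemma le_of_lt_minEntropy {model : Fin m → RelayModel} {C : ℝ}
    (hC : C ∈ upperBounds (zeroErrorRates model)) {p : (Fin (m + 1) → Sym) → ℝ}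
    (hp : p ∈ inputDistributions model) {R : ℝ} (hR : R < minEntropy p) : R ≤ C := by
  obtain ⟨K, z, hK, hz, hlim⟩ := exists_tendsto_empirical hp.1
  obtain ⟨R', hRR', hR'⟩ := exists_between hR
  have hpos : ∀ᶠ L in atTop, 0 < K L := hK.eventually_gt_atTop 0
  have hent : ∀ᶠ L in atTop, R' < minEntropy (empirical (z L)) := by
    refine Tendsto.eventually_const_lt hR' ((continuousOn_minEntropy m p hp.1).tendsto.comp
      (tendsto_nhdsWithin_iff.2 ⟨hlim, ?_⟩))
    filter_upwards [hpos] with L hL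
    have : Nonempty (Fin (K L)) := ⟨⟨0, hL⟩⟩
    exact empirical_mem_stdSimplex _
  -- the constant `9` bounds the number of pairs of symbols
  have herr : ∀ᶠ L in atTop, 9 * (Real.log (K L + 1) + 1) / Real.log 2 ≤ K L * (R' - R) := by
    have h1 : Tendsto (fun L => 9 * ((Real.log (K L + 1) + 1) / K L) / Real.log 2) atTop
        (𝓝 (9 * 0 / Real.log 2)) :=
      ((tendsto_log_succ_add_one_div.comp hK).const_mul 9).div_const _
    rw [mul_zero, zero_div] at h1
    filter_upwards [hpos, h1.eventually_lt_const (sub_pos.2 hRR')] with L hL h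
    have hL' : (0 : ℝ) < K L := Nat.cast_pos.2 hL
    refine le_of_eq_of_le ?_ (mul_le_mul_of_nonneg_left h.le hL'.le)
    field_simp
  obtain ⟨L, hL, hent, herr⟩ := (hpos.and (hent.and herr)).exists
  have hne : Nonempty (Fin (K L)) := ⟨⟨0, hL⟩⟩
  have hL' : (0 : ℝ) < K L := Nat.cast_pos.2 hL
  have hl2 : 0 < Real.log 2 := Real.log_pos one_lt_two
  obtain ⟨h1, h2⟩ := (le_minEntropy_iff (empirical_mem_stdSimplex (z L))).1 hent.le
  set M : ℕ := ⌈(2 : ℝ) ^ (K L * R)⌉₊ with hM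
  have hMpos : 0 < M := Nat.ceil_pos.2 (by positivity)
  have hlogM : K L * R ≤ Real.logb 2 M := by
    rw [Real.le_logb_iff_rpow_le one_lt_two (Nat.cast_pos.2 hMpos)]
    exact Nat.le_ceil _
  have hcount {β : Type} [Fintype β] [DecidableEq β] (hβ : Fintype.card β ≤ 3)
      (Y : (Fin (m + 1) → Sym) → Sym) (X : (Fin (m + 1) → Sym) → β)
      (h : R' ≤ condEntropy (empirical (z L)) Y X) :
      M ≤ (rearrangements (fun t => Y (z L t)) fun t => X (z L t)).card := by
    have hc := mul_condEntropy_sub_le_logb_card (z L) Y X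
    set N := (rearrangements (fun t => Y (z L t)) fun t => X (z L t)).card
    have hNpos : 0 < N := card_rearrangements_pos _ _
    rw [hM, Nat.ceil_le, ← Real.le_logb_iff_rpow_le one_lt_two (Nat.cast_pos.2 hNpos)]
    refine le_trans ?_ hc
    rw [Fintype.card_fin]
    have h3 : (Fintype.card β * Fintype.card Sym : ℝ) ≤ 9 := by
      have : (Fintype.card β : ℝ) ≤ 3 := by exact_mod_cast hβ
      have h' : (Fintype.card Sym : ℝ) = 3 := by simp [Sym]
      rw [h']
      linarith
    have hlog : 0 ≤ Real.log (K L + 1) := Real.log_nonneg (by linarith)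
    have h4 : Fintype.card β * Fintype.card Sym * (Real.log (K L + 1) + 1) / Real.log 2 ≤
        9 * (Real.log (K L + 1) + 1) / Real.log 2 := by gcongr
    have h5 := mul_le_mul_of_nonneg_left h hL'.le
    linarith
  choose τ hτ hτinj using fun i : Fin m => exists_perms
    (hcount (by simp [Sym]) (fun x => relayOutput x i) (fun x => x i.succ) (h1 i))
  obtain ⟨τs, -, hτs⟩ := exists_perms
    (hcount (by simp) (sinkOutput (m := m)) (fun _ => ()) h2)
  have hrate (B : ℕ) (hB : 0 < B) : (B - m : ℕ) / (B : ℝ) * (Real.logb 2 M / K L) ≤ C := by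
    have := hC (mem_zeroErrorRates_of_perms hL hMpos (z L) (fun t => hp.2.1 _ (hz L t)) hτ hτinj
      hτs hB)
    rwa [Nat.cast_mul, mul_div_mul_comm] at this
  have hB : Tendsto (fun B : ℕ => ((B - m : ℕ) : ℝ) / (B : ℝ)) atTop (𝓝 1) := by
    have := (tendsto_const_div_atTop_nhds_zero_nat (m : ℝ)).const_sub 1
    rw [sub_zero] at this
    refine this.congr' ?_
    filter_upwards [eventually_gt_atTop 0, eventually_ge_atTop m] with B hB hBm
    rw [Nat.cast_sub hBm, sub_div, div_self (Nat.cast_ne_zero.2 hB.ne')]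
  have hfin : Real.logb 2 M / K L ≤ C := by
    have := hB.mul_const (Real.logb 2 M / K L)
    rw [one_mul] at this
    refine le_of_tendsto this ?_
    filter_upwards [eventually_gt_atTop 0] with B hB using hrate B hB
  refine le_trans ?_ hfin
  rwa [le_div_iff₀' hL']

lemma zero_mem_zeroErrorRates (model : Fin m → RelayModel) : (0 : ℝ) ∈ zeroErrorRates model := by
  have := mem_zeroErrorRates_of_causal (model := model) (W := Unit) one_pos
    (fun _ _ _ => some false) (fun _ _ _ _ h => by simp at h) (fun _ _ _ _ _ => rfl)
    (fun _ _ _ => rfl)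
  simpa using this

end HalfDuplexLine

end

theorem theorem1 (m : ℕ) (model : Fin m → HalfDuplexLine.RelayModel) :
    IsLUB (HalfDuplexLine.zeroErrorRates model) (HalfDuplexLine.zeroErrorCapacity model) ∧
      IsGreatest (HalfDuplexLine.minEntropy '' HalfDuplexLine.inputDistributions model)
        (HalfDuplexLine.zeroErrorCapacity model) := by
  open HalfDuplexLine in
  have hne : (zeroErrorRates model).Nonempty := ⟨0, zero_mem_zeroErrorRates model⟩
  obtain ⟨p₀, hp₀, -⟩ := exists_le_minEntropy (zero_mem_zeroErrorRates model)
  obtain ⟨p, hp, hmax⟩ := (isCompact_inputDistributions model).exists_isMaxOn ⟨p₀, hp₀⟩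
    ((continuousOn_minEntropy m).mono fun p hp => hp.1)
  have hub : minEntropy p ∈ upperBounds (zeroErrorRates model) := fun R hR => by
    obtain ⟨q, hq, hRq⟩ := exists_le_minEntropy hR
    exact hRq.trans (hmax hq)
  have hlub : IsLUB (zeroErrorRates model) (zeroErrorCapacity model) :=
    isLUB_csSup hne ⟨_, hub⟩
  have hC : zeroErrorCapacity model = minEntropy p :=
    le_antisymm (hlub.2 hub)
    (le_of_forall_lt_imp_le_of_dense fun R hR => le_of_lt_minEntropy hlub.1 hp hR)
  refine ⟨hlub, hC ▸ ⟨p, hp, rfl⟩, ?_⟩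
  rintro _ ⟨q, hq, rfl⟩
  exact hC ▸ hmax hq
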